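/- Let $\mathbb{O}=\mathbb{H}\oplus\mathbf{l}\,\mathbb{H}$ be the complex octonion algebra, where $\mathbb{H}$ is the quaternion algebra over $\mathbb{C}$ and $(a+\mathbf{l}b)(c+\mathbf{l}d)=(ac-d\bar b)+\mathbf{l}(\bar a d+cb)$, with standard basis $(e_0,\dots,e_7)=(1,\mathbf{i},\mathbf{j},\mathbf{k},\mathbf{l},\mathbf{li},\mathbf{lj},\mathbf{lk})$, conjugation $\bar u=\mathrm{Re}(u)-\mathrm{Im}(u)$ and symmetric bilinear form $B(u,v)=\mathrm{Re}(\bar u v)$. Let $$\Phi(x,u,v,w)=B(x,u\times v\times w),\qquad u\times v\times w=\tfrac12\big((u\bar v)w-(w\bar v)u\big),$$ be the Cayley four-form on $\mathbb{O}\cong\mathbb{C}^8$, and let $\mathrm{Spin}(7,\mathbb{C})$ be the identity component of $\{M\in \mathrm{SO}(8,\mathbb{C}) : M^*\Phi=\Phi\}$. For $\lambda\in\mathbb{C}^*$ put $$L_\lambda=\begin{pmatrix} P_\lambda & -iM_\lambda\\ iM_\lambda & P_\lambda\end{pmatrix},\qquad P_\lambda=\frac{\lambda+\lambda^{-1}}2,\quad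 M_\lambda=\frac{\lambda-\lambda^{-1}}2,$$ and define the $8\times 8$ block diagonal matrices (acting on $\mathbb{O}$ in the basis $(e_i)$) $$A_\lambda=L_\lambda\oplus L_\lambda\oplus L_\lambda\oplus L_\lambda,\qquad B_\mu=L_\mu\oplus L_{\mu^{-1}}\oplus I_4,\qquad C_\gamma=I_4\oplus L_\gamma\oplus L_{\gamma^{-1}}.$$ Then $h:(\mathbb{C}^*)^3\to \mathrm{SL}(8,\mathbb{C})$, $h(\lambda,\mu,\gamma)=A_\lambda B_\mu C_\gamma$, is a group homomorphism with kernel $\{\pm(1,1,1)\}$, and its image is a maximal torus of $\mathrm{Spin}(7,\mathbb{C})$. Here a torus is a Zariski closed subgroup of $\mathrm{SL}(8,\mathbb{C})$ that is isomorphic, as a linear algebraic group, to $(\mathbb{C}^*)^r$ for some $r\ge 0$, and a maximal torus of $\mathrm{Spin}(7,\mathbb{C})$ is a torus contained in $\mathrm{Spin}(7,\mathbb{C})$ that is maximal with respect to inclusion among such tori. -/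

import Mathlib

open scoped Quaternion Matrix

/-! ### Complex octonions

`ℍ[ℂ]` is the complex quaternion algebra; its `star` is the `ℂ`-linear quaternionic conjugation. -/

/-- The complex octonions `𝕆 = ℍ ⊕ 𝐥ℍ`; the pair `(a, b)` stands for `a + 𝐥 b`. -/
@[ext]
structure Octonion where
  /-- The component in `ℍ`. -/
  fst : ℍ[ℂ]
  /-- The element `b` in the component `𝐥 b`. -/
  snd : ℍ[ℂ]

namespace Octonion

noncomputable instance : Sub Octonion := ⟨fun x y => ⟨x.fst - y.fst, x.snd - y.snd⟩⟩

noncomputable instance : SMul ℂ Octonion := ⟨fun c x => ⟨c • x.fst, c • x.snd⟩⟩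

/-- Cayley–Dickson multiplication `(a + 𝐥b)(c + 𝐥d) = (ac - d b̄) + 𝐥(ā d + c b)`, with `𝐥² = -1`. -/
noncomputable instance : Mul Octonion :=
  ⟨fun x y => ⟨x.fst * y.fst - y.snd * star x.snd, star x.fst * y.snd + y.fst * x.snd⟩⟩

/-- Octonionic conjugation `u ↦ Re u - Im u`. -/
noncomputable def conj (u : Octonion) : Octonion := ⟨star u.fst, -u.snd⟩

/-- The coefficient of `1`. -/
def re (u : Octonion) : ℂ := u.fst.re

/-- The symmetric bilinear form `B(u, v) = Re(ū v)` of the octonion norm. -/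
noncomputable def B (u v : Octonion) : ℂ := (u.conj * v).re

/-- The three-fold cross product `u × v × w = ½ ((u v̄) w - (w v̄) u)`. -/
noncomputable def cross₃ (u v w : Octonion) : Octonion :=
  (1 / 2 : ℂ) • ((u * v.conj) * w - (w * v.conj) * u)

/-- The Cayley form `Φ(x, u, v, w) = B(x, u × v × w)`. -/
noncomputable def cayleyForm (x u v w : Octonion) : ℂ := B x (cross₃ u v w)

/-- The octonion `∑ xᵢ eᵢ` in the standard basis
`e₀, …, e₇ = 1, 𝐢, 𝐣, 𝐤, 𝐥, 𝐥𝐢, 𝐥𝐣, 𝐥𝐤`. -/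
def ofCoords (x : Fin 8 → ℂ) : Octonion :=
  ⟨⟨x 0, x 1, x 2, x 3⟩, ⟨x 4, x 5, x 6, x 7⟩⟩

end Octonion

/-! ### The group `Spin(7, ℂ)` -/

/-- The Cayley form in coordinates with respect to the standard basis. -/
noncomputable def cayleyPhi (x u v w : Fin 8 → ℂ) : ℂ :=
  Octonion.cayleyForm (.ofCoords x) (.ofCoords u) (.ofCoords v) (.ofCoords w)

/-- The group `{M ∈ SO(8, ℂ) | M^* Φ = Φ}`, as a subgroup of `SL(8, ℂ)`. Here `SO(8, ℂ)` is the
complex special orthogonal group (`M Mᵀ = 1` and `det M = 1`). -/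
noncomputable def cayleyStabilizer : Subgroup (Matrix.SpecialLinearGroup (Fin 8) ℂ) where
  carrier := {M | M.1 ∈ Matrix.specialOrthogonalGroup (Fin 8) ℂ ∧
    ∀ x u v w : Fin 8 → ℂ,
      cayleyPhi (M.1 *ᵥ x) (M.1 *ᵥ u) (M.1 *ᵥ v) (M.1 *ᵥ w) = cayleyPhi x u v w}
  one_mem' := ⟨one_mem _, by simp⟩
  mul_mem' := by
    rintro M N ⟨hM, hM'⟩ ⟨hN, hN'⟩
    refine ⟨mul_mem hM hN, fun x u v w => ?_⟩
    simp only [Matrix.SpecialLinearGroup.coe_mul, ← Matrix.mulVec_mulVec, hM', hN']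
  inv_mem' := by
    rintro M ⟨hM, hM'⟩
    have e : (M⁻¹).1 * M.1 = 1 := by
      rw [← Matrix.SpecialLinearGroup.coe_mul, inv_mul_cancel, Matrix.SpecialLinearGroup.coe_one]
    have e' : M.1 * (M⁻¹).1 = 1 := by
      rw [← Matrix.SpecialLinearGroup.coe_mul, mul_inv_cancel, Matrix.SpecialLinearGroup.coe_one]
    have o := hM
    rw [Matrix.mem_specialOrthogonalGroup_iff, Matrix.mem_orthogonalGroup_iff'] at o
    have t : (M⁻¹).1 = M.1ᵀ := (left_inv_eq_right_inv o.1 e').symm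
    refine ⟨?_, fun x u v w => ?_⟩
    · rw [Matrix.mem_specialOrthogonalGroup_iff, Matrix.mem_orthogonalGroup_iff, t,
        Matrix.transpose_transpose, Matrix.det_transpose]
      exact o
    · rw [← hM']
      simp only [Matrix.mulVec_mulVec, e', Matrix.one_mulVec]

/-- `Spin(7, ℂ)`: the identity component of the stabilizer of the Cayley form in `SO(8, ℂ)`. -/
noncomputable def Spin7 : Subgroup (Matrix.SpecialLinearGroup (Fin 8) ℂ) :=
  (Subgroup.connectedComponentOfOne cayleyStabilizer).map cayleyStabilizer.subtype

/-! ### Algebraic tori in `SL(n, ℂ)` -/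

section Torus

variable {n : Type*} [Fintype n] [DecidableEq n]

/-- The value of a polynomial in the matrix entries. -/
noncomputable def evalEntries (p : MvPolynomial (n × n) ℂ)
    (g : Matrix.SpecialLinearGroup n ℂ) : ℂ :=
  MvPolynomial.eval (fun ij : n × n => g.1 ij.1 ij.2) p

/-- Zariski closed subsets of `SL(n, ℂ)`. -/
def IsZariskiClosed (S : Set (Matrix.SpecialLinearGroup n ℂ)) : Prop :=
  ∃ I : Set (MvPolynomial (n × n) ℂ), S = {g | ∀ p ∈ I, evalEntries p g = 0}

/-- `T` is an algebraic torus: a Zariski closed subgroup of `SL(n, ℂ)` that is isomorphic, as a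
linear algebraic group, to `(ℂ^×)^r` for some `r`. The isomorphism has matrix entries that are
Laurent polynomials in the coordinates of `(ℂ^×)^r`, and the coordinates of its inverse are
polynomials in the matrix entries. -/
def IsAlgebraicTorus (T : Subgroup (Matrix.SpecialLinearGroup n ℂ)) : Prop :=
  IsZariskiClosed (T : Set (Matrix.SpecialLinearGroup n ℂ)) ∧
  ∃ (r : ℕ) (f : (Fin r → ℂˣ) ≃* T),
    (∀ i j, ∃ p : MvPolynomial (Fin r ⊕ Fin r) ℂ, ∀ t : Fin r → ℂˣ,
      (f t).1.1 i j =
        MvPolynomial.eval (Sum.elim (fun k => (t k : ℂ)) (fun k => ((t k)⁻¹ : ℂ))) p) ∧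
    (∀ k, ∃ p : MvPolynomial (n × n) ℂ, ∀ g : T, ((f.symm g k : ℂˣ) : ℂ) = evalEntries p g.1)

/-- `T` is a maximal torus of `G`: it is maximal among the algebraic tori contained in `G`. -/
def IsMaximalTorus (T G : Subgroup (Matrix.SpecialLinearGroup n ℂ)) : Prop :=
  Maximal (fun T' => IsAlgebraicTorus T' ∧ T' ≤ G) T

end Torus

/-! ### The homomorphism `h` -/

/-- `L_a = [[P_a, -i M_a], [i M_a, P_a]]` with `P_a = (a + a⁻¹)/2` and `M_a = (a - a⁻¹)/2`. -/
noncomputable def Lmat (a : ℂˣ) : Matrix (Fin 2) (Fin 2) ℂ :=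
  !![((a : ℂ) + (a : ℂ)⁻¹) / 2, -Complex.I * (((a : ℂ) - (a : ℂ)⁻¹) / 2);
     Complex.I * (((a : ℂ) - (a : ℂ)⁻¹) / 2), ((a : ℂ) + (a : ℂ)⁻¹) / 2]

/-- The bijection sending the position `p` inside the block `b` to the index `2 b + p`. -/
def blockIndex : Fin 2 × Fin 4 ≃ Fin 8 :=
  (Equiv.prodComm (Fin 2) (Fin 4)).trans (finProdFinEquiv (m := 4) (n := 2))

/-- The `8 × 8` block diagonal matrix `D₀ ⊕ D₁ ⊕ D₂ ⊕ D₃`. -/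
def blockSum (D : Fin 4 → Matrix (Fin 2) (Fin 2) ℂ) : Matrix (Fin 8) (Fin 8) ℂ :=
  Matrix.reindex blockIndex blockIndex (Matrix.blockDiagonal D)

/-- `A_a = L_a ⊕ L_a ⊕ L_a ⊕ L_a`. -/
noncomputable def Amat (a : ℂˣ) : Matrix (Fin 8) (Fin 8) ℂ :=
  blockSum ![Lmat a, Lmat a, Lmat a, Lmat a]

/-- `B_b = L_b ⊕ L_{b⁻¹} ⊕ I₄`. -/
noncomputable def Bmat (b : ℂˣ) : Matrix (Fin 8) (Fin 8) ℂ :=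
  blockSum ![Lmat b, Lmat b⁻¹, 1, 1]

/-- `C_c = I₄ ⊕ L_c ⊕ L_{c⁻¹}`. -/
noncomputable def Cmat (c : ℂˣ) : Matrix (Fin 8) (Fin 8) ℂ :=
  blockSum ![1, 1, Lmat c, Lmat c⁻¹]

theorem Lmat_one : Lmat 1 = 1 := by
  ext i j
  fin_cases i <;> fin_cases j <;> simp [Lmat]

theorem Lmat_mul (a b : ℂˣ) : Lmat (a * b) = Lmat a * Lmat b := by
  have ha := a.ne_zero
  have hb := b.ne_zero
  ext i j
  fin_cases i <;> fin_cases j <;> simp [Lmat, Matrix.mul_apply, Fin.sum_univ_two] <;>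
    field_simp <;> ring_nf <;> simp only [Complex.I_sq] <;> ring

theorem det_Lmat (a : ℂˣ) : (Lmat a).det = 1 := by
  have ha := a.ne_zero
  simp only [Lmat, Matrix.det_fin_two_of]
  field_simp
  ring_nf
  simp only [Complex.I_sq]
  ring

theorem blockSum_mul (D E : Fin 4 → Matrix (Fin 2) (Fin 2) ℂ) :
    blockSum D * blockSum E = blockSum (fun b => D b * E b) := by
  unfold blockSum
  rw [Matrix.blockDiagonal_mul, Matrix.reindex_apply, Matrix.reindex_apply, Matrix.reindex_apply,
    Matrix.submatrix_mul_equiv]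

theorem blockSum_one : blockSum (fun _ => 1) = 1 := by
  unfold blockSum
  change Matrix.reindex blockIndex blockIndex (Matrix.blockDiagonal 1) = 1
  rw [Matrix.blockDiagonal_one, Matrix.reindex_apply, Matrix.submatrix_one_equiv]

theorem det_blockSum (D : Fin 4 → Matrix (Fin 2) (Fin 2) ℂ) :
    (blockSum D).det = ∏ b, (D b).det := by
  unfold blockSum
  rw [Matrix.det_reindex_self, Matrix.det_blockDiagonal]

theorem ABC_eq (a b c : ℂˣ) : Amat a * Bmat b * Cmat c =
    blockSum ![Lmat (a * b), Lmat (a * b⁻¹), Lmat (a * c), Lmat (a * c⁻¹)] := by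
  unfold Amat Bmat Cmat
  rw [blockSum_mul, blockSum_mul]
  congr 1
  funext i
  fin_cases i <;> simp [Lmat_mul]

/-- The homomorphism `h : (ℂ^×)³ → SL(8, ℂ)`, `h(a, b, c) = A_a B_b C_c`. -/
noncomputable def torusHom : ℂˣ × ℂˣ × ℂˣ →* Matrix.SpecialLinearGroup (Fin 8) ℂ where
  toFun t := ⟨Amat t.1 * Bmat t.2.1 * Cmat t.2.2, by
    simp [ABC_eq, det_blockSum, Fin.prod_univ_four, det_Lmat]⟩
  map_one' := by
    apply Subtype.ext
    change Amat 1 * Bmat 1 * Cmat 1 = 1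
    rw [ABC_eq, ← blockSum_one]
    congr 1
    funext i
    fin_cases i <;> simp [Lmat_one]
  map_mul' s t := by
    apply Subtype.ext
    change Amat (s.1 * t.1) * Bmat (s.2.1 * t.2.1) * Cmat (s.2.2 * t.2.2) =
      (Amat s.1 * Bmat s.2.1 * Cmat s.2.2) * (Amat t.1 * Bmat t.2.1 * Cmat t.2.2)
    rw [ABC_eq, ABC_eq, ABC_eq, blockSum_mul]
    congr 1
    funext i
    fin_cases i <;> simp [← Lmat_mul, mul_comm, mul_left_comm, mul_assoc]

/-! The vectors `isoVec s b` diagonalise every block sum of four `L_{x_b}`: the block `L_a` has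
eigenvalues `a` and `a⁻¹` on its two isotropic lines. The image of `h` consists exactly of the block
sums with `x₀x₁ = x₂x₃`: a square root of `x₀x₁` recovers the three parameters, and its sign is the
kernel.

In isotropic coordinates (`cayleyPhi_eq_isoWedge`) the Cayley form has six terms of weight zero and
two mixed terms of weights `(x₀x₁/(x₂x₃))^{±1}`. Hence a block sum preserves it exactly when `x₀x₁ =
x₂x₃`. Since `(ℂˣ)³` is connected, the image of `h` lies in the identity component.

For maximality, the image contains an element with eight distinct eigenvalues. A matrix commuting
with it keeps every isotropic line; orthogonality makes the eigenvalues on paired lines inverse, so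
the matrix is a block sum (`exists_eq_torusMat`), and invariance of the form puts it in the image.
Any larger torus is commutative, hence equal to the image. The same description gives Zariski
closedness. -/

/-! ### Isotropic eigenbasis of the block sums -/

/-- The torus element `L_{x₀} ⊕ L_{x₁} ⊕ L_{x₂} ⊕ L_{x₃}`. -/
noncomputable def torusMat (x : Fin 4 → ℂˣ) : Matrix (Fin 8) (Fin 8) ℂ :=
  blockSum fun b => Lmat (x b)

/-- The coordinate `w_{2b} - s i w_{2b+1}` with respect to the isotropic eigenbasis of the torus. -/
noncomputable def isoCoord (s : ℤˣ) (b : Fin 4) (w : Fin 8 → ℂ) : ℂ :=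
  w (blockIndex (0, b)) - ((s : ℤ) : ℂ) * Complex.I * w (blockIndex (1, b))

/-- The isotropic eigenvector `e_{2b} + s i e_{2b+1}` of the torus. -/
noncomputable def isoVec (s : ℤˣ) (b : Fin 4) : Fin 8 → ℂ :=
  Pi.single (blockIndex (0, b)) 1 + (((s : ℤ) : ℂ) * Complex.I) • Pi.single (blockIndex (1, b)) 1

theorem blockSum_apply (D : Fin 4 → Matrix (Fin 2) (Fin 2) ℂ) (p q : Fin 2) (b c : Fin 4) :
    blockSum D (blockIndex (p, b)) (blockIndex (q, c)) = if b = c then D b p q else 0 := by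
  simp [blockSum, Matrix.blockDiagonal_apply]

theorem blockSum_mulVec (D : Fin 4 → Matrix (Fin 2) (Fin 2) ℂ) (w : Fin 8 → ℂ) (p : Fin 2)
    (b : Fin 4) : (blockSum D *ᵥ w) (blockIndex (p, b)) =
      ∑ q, D b p q * w (blockIndex (q, b)) := by
  rw [Matrix.mulVec, dotProduct, ← blockIndex.sum_comp, Fintype.sum_prod_type]
  simp [blockSum_apply]

theorem isoCoord_torusMat (x : Fin 4 → ℂˣ) (s : ℤˣ) (b : Fin 4) (w : Fin 8 → ℂ) :
    isoCoord s b (torusMat x *ᵥ w) = ((x b ^ (s : ℤ) : ℂˣ) : ℂ) * isoCoord s b w := by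
  simp only [isoCoord, torusMat, blockSum_mulVec, Fin.sum_univ_two, Lmat]
  rcases Int.units_eq_one_or s with rfl | rfl <;> simp <;> ring_nf <;>
    simp only [Complex.I_sq] <;> ring

theorem isoCoord_isoVec (s t : ℤˣ) (b c : Fin 4) :
    isoCoord s b (isoVec t c) = if s = t ∧ b = c then 2 else 0 := by
  by_cases h : b = c
  · subst h
    rcases Int.units_eq_one_or s with rfl | rfl <;> rcases Int.units_eq_one_or t with rfl | rfl <;>
      simp [isoCoord, isoVec] <;> norm_num
  · simp [isoCoord, isoVec, h]

theorem ext_isoCoord {v w : Fin 8 → ℂ} (h : ∀ s b, isoCoord s b v = isoCoord s b w) : v = w := by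
  funext i
  obtain ⟨⟨p, b⟩, rfl⟩ := blockIndex.surjective i
  have h₁ := h 1 b
  have h₂ := h (-1) b
  simp only [isoCoord, Units.val_one, Units.val_neg, Int.cast_one, Int.cast_neg] at h₁ h₂
  fin_cases p
  · change v (blockIndex (0, b)) = w (blockIndex (0, b))
    linear_combination (h₁ + h₂) / 2
  · change v (blockIndex (1, b)) = w (blockIndex (1, b))
    -- The half-difference yields the odd coordinate times `-I²`; the second term replaces `I²` by
    -- `-1`.
    linear_combination Complex.I * (h₁ - h₂) / 2 +
      (v (blockIndex (1, b)) - w (blockIndex (1, b))) * Complex.I_sq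

theorem torusMat_mulVec_isoVec (x : Fin 4 → ℂˣ) (s : ℤˣ) (b : Fin 4) :
    torusMat x *ᵥ isoVec s b = ((x b ^ (s : ℤ) : ℂˣ) : ℂ) • isoVec s b := by
  refine ext_isoCoord fun t c => ?_
  rw [isoCoord_torusMat, isoCoord_isoVec]
  have : isoCoord t c (((x b ^ (s : ℤ) : ℂˣ) : ℂ) • isoVec s b) =
      ((x b ^ (s : ℤ) : ℂˣ) : ℂ) * isoCoord t c (isoVec s b) := by
    simp only [isoCoord, Pi.smul_apply, smul_eq_mul]; ring
  rw [this, isoCoord_isoVec]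
  split_ifs with h
  · rw [h.1, h.2]
  · simp

theorem ext_mulVec_isoVec {M N : Matrix (Fin 8) (Fin 8) ℂ}
    (h : ∀ s b, M *ᵥ isoVec s b = N *ᵥ isoVec s b) : M = N := by
  ext i j
  obtain ⟨⟨p, b⟩, rfl⟩ := blockIndex.surjective j
  have h₁ := congrFun (h 1 b) i
  have h₂ := congrFun (h (-1) b) i
  simp only [isoVec, Units.val_one, Units.val_neg, Int.cast_one, Int.cast_neg, Matrix.mulVec_add,
    Matrix.mulVec_smul, Matrix.mulVec_single_one, Pi.add_apply, Pi.smul_apply, smul_eq_mul,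
    Matrix.col_apply] at h₁ h₂
  fin_cases p
  · change M i (blockIndex (0, b)) = N i (blockIndex (0, b))
    linear_combination (h₁ + h₂) / 2
  · change M i (blockIndex (1, b)) = N i (blockIndex (1, b))
    linear_combination -Complex.I * (h₁ - h₂) / 2 +
      (M i (blockIndex (1, b)) - N i (blockIndex (1, b))) * Complex.I_sq

/-! ### The Cayley form in isotropic coordinates -/

/-- The value on four vectors of the wedge product of four coordinates. -/
noncomputable def wedge₄ (f : Fin 4 → (Fin 8 → ℂ) → ℂ) (x : Fin 4 → Fin 8 → ℂ) : ℂ :=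
  Matrix.det (Matrix.of fun i j => f i (x j))

theorem wedge₄_expand (f : Fin 4 → (Fin 8 → ℂ) → ℂ) (x : Fin 4 → Fin 8 → ℂ) :
    wedge₄ f x =
      f 0 (x 0) * (f 1 (x 1) * (f 2 (x 2) * f 3 (x 3) - f 2 (x 3) * f 3 (x 2)) -
        f 1 (x 2) * (f 2 (x 1) * f 3 (x 3) - f 2 (x 3) * f 3 (x 1)) +
        f 1 (x 3) * (f 2 (x 1) * f 3 (x 2) - f 2 (x 2) * f 3 (x 1))) -
      f 0 (x 1) * (f 1 (x 0) * (f 2 (x 2) * f 3 (x 3) - f 2 (x 3) * f 3 (x 2)) -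
        f 1 (x 2) * (f 2 (x 0) * f 3 (x 3) - f 2 (x 3) * f 3 (x 0)) +
        f 1 (x 3) * (f 2 (x 0) * f 3 (x 2) - f 2 (x 2) * f 3 (x 0))) +
      f 0 (x 2) * (f 1 (x 0) * (f 2 (x 1) * f 3 (x 3) - f 2 (x 3) * f 3 (x 1)) -
        f 1 (x 1) * (f 2 (x 0) * f 3 (x 3) - f 2 (x 3) * f 3 (x 0)) +
        f 1 (x 3) * (f 2 (x 0) * f 3 (x 1) - f 2 (x 1) * f 3 (x 0))) -
      f 0 (x 3) * (f 1 (x 0) * (f 2 (x 1) * f 3 (x 2) - f 2 (x 2) * f 3 (x 1)) -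
        f 1 (x 1) * (f 2 (x 0) * f 3 (x 2) - f 2 (x 2) * f 3 (x 0)) +
        f 1 (x 2) * (f 2 (x 0) * f 3 (x 1) - f 2 (x 1) * f 3 (x 0))) := by
  simp [wedge₄, Matrix.det_succ_row_zero, Fin.sum_univ_succ, Fin.succAbove]
  ring

theorem wedge₄_smul (c : Fin 4 → ℂ) (f : Fin 4 → (Fin 8 → ℂ) → ℂ) (x : Fin 4 → Fin 8 → ℂ) :
    wedge₄ (fun i v => c i * f i v) x = (∏ i, c i) * wedge₄ f x :=
  Matrix.det_mul_column c (Matrix.of fun i j => f i (x j))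

/-- The wedge product of four standard coordinates. -/
noncomputable abbrev stdWedge (a b c d : Fin 8) (x : Fin 4 → Fin 8 → ℂ) : ℂ :=
  wedge₄ ![fun v => v a, fun v => v b, fun v => v c, fun v => v d] x

/-- The wedge product of four isotropic coordinates. -/
noncomputable abbrev isoWedge (s : Fin 4 → ℤˣ) (b : Fin 4 → Fin 4) (x : Fin 4 → Fin 8 → ℂ) : ℂ :=
  wedge₄ (fun i => isoCoord (s i) (b i)) x

namespace Octonion

theorem ofCoords_mul (x y : Fin 8 → ℂ) : ofCoords x * ofCoords y = ofCoords ![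
    x 0 * y 0 - x 1 * y 1 - x 2 * y 2 - x 3 * y 3 - x 4 * y 4 - x 5 * y 5 - x 6 * y 6 - x 7 * y 7,
    x 0 * y 1 + x 1 * y 0 + x 2 * y 3 - x 3 * y 2 + x 5 * y 4 - x 4 * y 5 + x 7 * y 6 - x 6 * y 7,
    x 0 * y 2 + x 2 * y 0 + x 3 * y 1 - x 1 * y 3 + x 6 * y 4 - x 4 * y 6 + x 5 * y 7 - x 7 * y 5,
    x 0 * y 3 + x 3 * y 0 + x 1 * y 2 - x 2 * y 1 + x 7 * y 4 - x 4 * y 7 + x 6 * y 5 - x 5 * y 6,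
    x 0 * y 4 + x 4 * y 0 + x 1 * y 5 - x 5 * y 1 + x 2 * y 6 - x 6 * y 2 + x 3 * y 7 - x 7 * y 3,
    x 0 * y 5 + x 5 * y 0 + x 4 * y 1 - x 1 * y 4 + x 3 * y 6 - x 6 * y 3 + x 7 * y 2 - x 2 * y 7,
    x 0 * y 6 + x 6 * y 0 + x 4 * y 2 - x 2 * y 4 + x 1 * y 7 - x 7 * y 1 + x 5 * y 3 - x 3 * y 5,
    x 0 * y 7 + x 7 * y 0 + x 4 * y 3 - x 3 * y 4 + x 2 * y 5 - x 5 * y 2 + x 6 * y 1 - x 1 * y 6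
    ] := by
  have h : ofCoords x * ofCoords y = ⟨(ofCoords x).fst * (ofCoords y).fst -
      (ofCoords y).snd * star (ofCoords x).snd, star (ofCoords x).fst * (ofCoords y).snd +
      (ofCoords y).fst * (ofCoords x).snd⟩ := rfl
  rw [h]
  ext <;> simp <;> simp [ofCoords] <;> ring

theorem conj_ofCoords (x : Fin 8 → ℂ) :
    (ofCoords x).conj = ofCoords ![x 0, -x 1, -x 2, -x 3, -x 4, -x 5, -x 6, -x 7] := by
  ext <;> simp [conj] <;> simp [ofCoords]

theorem B_ofCoords (x y : Fin 8 → ℂ) : B (ofCoords x) (ofCoords y) =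
    x 0 * y 0 + x 1 * y 1 + x 2 * y 2 + x 3 * y 3 + x 4 * y 4 + x 5 * y 5 + x 6 * y 6 +
      x 7 * y 7 := by
  rw [B, conj_ofCoords, ofCoords_mul]
  simp only [re, ofCoords, Matrix.cons_val]
  ring

theorem ofCoords_sub (x y : Fin 8 → ℂ) : ofCoords x - ofCoords y = ofCoords (x - y) := rfl

theorem smul_ofCoords (c : ℂ) (x : Fin 8 → ℂ) : c • ofCoords x = ofCoords (c • x) := rfl

end Octonion

/-- Direct expansion by the multiplication table; afterwards the octonion product is no longer
needed. -/
theorem cayleyPhi_eq_stdWedge (x : Fin 4 → Fin 8 → ℂ) :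
    cayleyPhi (x 0) (x 1) (x 2) (x 3) =
      stdWedge 0 1 2 3 x - stdWedge 0 1 4 5 x - stdWedge 0 1 6 7 x - stdWedge 0 2 4 6 x +
      stdWedge 0 2 5 7 x - stdWedge 0 3 4 7 x - stdWedge 0 3 5 6 x - stdWedge 1 2 4 7 x -
      stdWedge 1 2 5 6 x + stdWedge 1 3 4 6 x - stdWedge 1 3 5 7 x - stdWedge 2 3 4 5 x -
      stdWedge 2 3 6 7 x + stdWedge 4 5 6 7 x := by
  rw [cayleyPhi, Octonion.cayleyForm, Octonion.cross₃, Octonion.conj_ofCoords,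
    Octonion.ofCoords_mul, Octonion.ofCoords_mul, Octonion.ofCoords_mul, Octonion.ofCoords_mul,
    Octonion.ofCoords_sub, Octonion.smul_ofCoords, Octonion.B_ofCoords]
  simp only [wedge₄_expand, Matrix.cons_val, Pi.sub_apply, Pi.smul_apply, smul_eq_mul]
  ring

/-- Writing `z^±` for the isotropic coordinates of a block, `z⁺ ∧ z⁻` is `2i` times the wedge of its
two standard coordinates; two blocks give `(2i)² = -4`. -/
theorem stdWedge_pair_eq_isoWedge (b c : Fin 4) (x : Fin 4 → Fin 8 → ℂ) :
    stdWedge (blockIndex (0, b)) (blockIndex (1, b)) (blockIndex (0, c)) (blockIndex (1, c)) x =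
      -(1 / 4) * isoWedge ![1, -1, 1, -1] ![b, b, c, c] x := by
  simp only [wedge₄_expand, isoCoord, Matrix.cons_val, Units.val_one, Units.val_neg, Int.cast_one,
    Int.cast_neg]
  ring_nf
  simp only [Complex.I_sq]
  ring

-- Over real vectors the left side is minus the real part of `z₀ ∧ z₁ ∧ z̄₂ ∧ z̄₃` with `z_b =
-- w_{2b} - i w_{2b+1}`; the right side is its complexification.
set_option maxRecDepth 20000 in
theorem stdWedge_mixed_eq_isoWedge (x : Fin 4 → Fin 8 → ℂ) :
    -stdWedge 0 2 4 6 x + stdWedge 0 2 5 7 x - stdWedge 0 3 4 7 x - stdWedge 0 3 5 6 x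
      - stdWedge 1 2 4 7 x - stdWedge 1 2 5 6 x + stdWedge 1 3 4 6 x - stdWedge 1 3 5 7 x =
    -(1 / 2) * (isoWedge ![1, 1, -1, -1] ![0, 1, 2, 3] x +
      isoWedge ![-1, -1, 1, 1] ![0, 1, 2, 3] x) := by
  have h : blockIndex (0, 0) = 0 ∧ blockIndex (1, 0) = 1 ∧ blockIndex (0, 1) = 2 ∧
      blockIndex (1, 1) = 3 ∧ blockIndex (0, 2) = 4 ∧ blockIndex (1, 2) = 5 ∧
      blockIndex (0, 3) = 6 ∧ blockIndex (1, 3) = 7 := by decide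
  obtain ⟨h0, h1, h2, h3, h4, h5, h6, h7⟩ := h
  simp only [wedge₄_expand, isoCoord, Matrix.cons_val, Units.val_one, Units.val_neg, Int.cast_one,
    Int.cast_neg, h0, h1, h2, h3, h4, h5, h6, h7]
  ring_nf
  simp only [Complex.I_sq, Complex.I_pow_four]
  ring

theorem cayleyPhi_eq_isoWedge (x : Fin 4 → Fin 8 → ℂ) :
    cayleyPhi (x 0) (x 1) (x 2) (x 3) =
      -(1 / 4) * isoWedge ![1, -1, 1, -1] ![0, 0, 1, 1] x +
      1 / 4 * isoWedge ![1, -1, 1, -1] ![0, 0, 2, 2] x +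
      1 / 4 * isoWedge ![1, -1, 1, -1] ![0, 0, 3, 3] x +
      1 / 4 * isoWedge ![1, -1, 1, -1] ![1, 1, 2, 2] x +
      1 / 4 * isoWedge ![1, -1, 1, -1] ![1, 1, 3, 3] x -
      1 / 4 * isoWedge ![1, -1, 1, -1] ![2, 2, 3, 3] x -
      1 / 2 * isoWedge ![1, 1, -1, -1] ![0, 1, 2, 3] x -
      1 / 2 * isoWedge ![-1, -1, 1, 1] ![0, 1, 2, 3] x := by
  have h01 : stdWedge 0 1 2 3 x = _ := stdWedge_pair_eq_isoWedge 0 1 x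
  have h02 : stdWedge 0 1 4 5 x = _ := stdWedge_pair_eq_isoWedge 0 2 x
  have h03 : stdWedge 0 1 6 7 x = _ := stdWedge_pair_eq_isoWedge 0 3 x
  have h12 : stdWedge 2 3 4 5 x = _ := stdWedge_pair_eq_isoWedge 1 2 x
  have h13 : stdWedge 2 3 6 7 x = _ := stdWedge_pair_eq_isoWedge 1 3 x
  have h23 : stdWedge 4 5 6 7 x = _ := stdWedge_pair_eq_isoWedge 2 3 x
  rw [cayleyPhi_eq_stdWedge]
  linear_combination h01 - h02 - h03 - h12 - h13 + h23 + stdWedge_mixed_eq_isoWedge x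

theorem isoWedge_torusMat (t : Fin 4 → ℂˣ) (s : Fin 4 → ℤˣ) (b : Fin 4 → Fin 4)
    (x : Fin 4 → Fin 8 → ℂ) :
    isoWedge s b (fun j => torusMat t *ᵥ x j) =
      (∏ i, ((t (b i) ^ (s i : ℤ) : ℂˣ) : ℂ)) * isoWedge s b x := by
  rw [← wedge₄_smul]
  simp only [wedge₄, isoCoord_torusMat]

theorem cayleyPhi_torusMat {t : Fin 4 → ℂˣ} (ht : t 0 * t 1 = t 2 * t 3) (x u v w : Fin 8 → ℂ) :
    cayleyPhi (torusMat t *ᵥ x) (torusMat t *ᵥ u) (torusMat t *ᵥ v) (torusMat t *ᵥ w) =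
      cayleyPhi x u v w := by
  -- The weights of the two mixed terms; in the other six, each block contributes `t_b t_b⁻¹`.
  have h₁ : ((t 0 * t 1 * (t 2)⁻¹ * (t 3)⁻¹ : ℂˣ) : ℂ) = 1 := by
    rw [ht]; simp [mul_comm, mul_left_comm]
  have h₂ : (((t 0)⁻¹ * (t 1)⁻¹ * t 2 * t 3 : ℂˣ) : ℂ) = 1 := by
    rw [← mul_inv, ht, mul_assoc]; simp
  have h := cayleyPhi_eq_isoWedge fun j => torusMat t *ᵥ ![x, u, v, w] j
  simp only [isoWedge_torusMat, Fin.prod_univ_four, Matrix.cons_val, ← Units.val_mul,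
    Units.val_one, Units.val_neg, zpow_one, zpow_neg, mul_inv_cancel, one_mul,
    h₁, h₂] at h
  rw [h]
  exact (cayleyPhi_eq_isoWedge ![x, u, v, w]).symm

theorem cayleyPhi_smul (c : Fin 4 → ℂ) (x : Fin 4 → Fin 8 → ℂ) :
    cayleyPhi (c 0 • x 0) (c 1 • x 1) (c 2 • x 2) (c 3 • x 3) =
      (∏ i, c i) * cayleyPhi (x 0) (x 1) (x 2) (x 3) := by
  have h (s b) : isoWedge s b (fun j => c j • x j) = (∏ i, c i) * isoWedge s b x := by
    rw [isoWedge, wedge₄, isoWedge, wedge₄, ← Matrix.det_mul_row]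
    congr 1
    ext i j
    simp only [isoCoord, Matrix.of_apply, Pi.smul_apply, smul_eq_mul]
    ring
  rw [cayleyPhi_eq_isoWedge x, cayleyPhi_eq_isoWedge fun j => c j • x j]
  simp only [h]
  ring

/-- Only one mixed term survives, contributing `-(1/2) · 2⁴`. What matters later is that the value
is nonzero. -/
theorem cayleyPhi_isoVec :
    cayleyPhi (isoVec 1 0) (isoVec 1 1) (isoVec (-1) 2) (isoVec (-1) 3) = -8 := by
  have h := cayleyPhi_eq_isoWedge ![isoVec 1 0, isoVec 1 1, isoVec (-1) 2, isoVec (-1) 3]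
  simp only [wedge₄_expand, isoCoord_isoVec, Matrix.cons_val] at h
  rw [h]
  have h1 : (1 : ℤˣ) ≠ -1 := by decide
  simp [h1, h1.symm]
  norm_num

/-! ### The torus -/

theorem isoCoord_smul (s : ℤˣ) (b : Fin 4) (c : ℂ) (w : Fin 8 → ℂ) :
    isoCoord s b (c • w) = c * isoCoord s b w := by
  simp only [isoCoord, Pi.smul_apply, smul_eq_mul]
  ring

theorem isoVec_dotProduct_isoVec (b : Fin 4) : isoVec 1 b ⬝ᵥ isoVec (-1) b = 2 := by
  simp [isoVec]
  norm_num

theorem torusMat_mul (x y : Fin 4 → ℂˣ) : torusMat (x * y) = torusMat x * torusMat y := by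
  simp only [torusMat, blockSum_mul, Pi.mul_apply, Lmat_mul]

theorem torusMat_one : torusMat 1 = 1 := by
  simp only [torusMat, Pi.one_apply, Lmat_one, blockSum_one]

theorem torusMat_transpose (x : Fin 4 → ℂˣ) : (torusMat x)ᵀ = torusMat x⁻¹ := by
  have h (a : ℂˣ) : (Lmat a)ᵀ = Lmat a⁻¹ := by
    ext i j
    fin_cases i <;> fin_cases j <;> simp [Lmat] <;> ring
  unfold torusMat blockSum
  rw [Matrix.transpose_reindex, Matrix.blockDiagonal_transpose]
  simp only [h, Pi.inv_apply]

theorem torusMat_transpose_mul (x : Fin 4 → ℂˣ) : (torusMat x)ᵀ * torusMat x = 1 := by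
  rw [torusMat_transpose, ← torusMat_mul, inv_mul_cancel, torusMat_one]

theorem torusMat_injective : Function.Injective torusMat := by
  intro x y h
  funext b
  have := congrArg (fun M => isoCoord 1 b (M *ᵥ isoVec 1 b)) h
  simpa [isoCoord_torusMat, isoCoord_isoVec, Units.ext_iff] using this

theorem coe_torusHom (t : ℂˣ × ℂˣ × ℂˣ) : (torusHom t).1 =
    torusMat ![t.1 * t.2.1, t.1 * t.2.1⁻¹, t.1 * t.2.2, t.1 * t.2.2⁻¹] := by
  refine (ABC_eq _ _ _).trans ?_
  unfold torusMat
  congr 1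
  funext b
  fin_cases b <;> rfl

theorem mem_range_torusHom_iff {g : Matrix.SpecialLinearGroup (Fin 8) ℂ} :
    g ∈ torusHom.range ↔ ∃ x : Fin 4 → ℂˣ, x 0 * x 1 = x 2 * x 3 ∧ g.1 = torusMat x := by
  constructor
  · rintro ⟨t, rfl⟩
    refine ⟨_, ?_, coe_torusHom t⟩
    simp [mul_left_comm]
  · rintro ⟨x, hx, hg⟩
    obtain ⟨a, ha⟩ := IsAlgClosed.exists_pow_nat_eq ((x 0 * x 1 : ℂˣ) : ℂ) two_pos
    have ha0 : a ≠ 0 := by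
      rintro rfl
      exact (x 0 * x 1).ne_zero (by rw [← ha]; simp)
    lift a to ℂˣ using ha0.isUnit
    have ha' : a * a = x 0 * x 1 := by
      rw [← sq]; exact_mod_cast ha
    -- Forced by `ab = x₀` and `ac = x₂`; the other two blocks then match because `a² = x₀x₁ =
    -- x₂x₃`.
    refine ⟨(a, x 0 * a⁻¹, x 2 * a⁻¹), Subtype.ext ?_⟩
    rw [coe_torusHom, hg]
    congr 1
    funext b
    fin_cases b
    · simp
    · simpa [mul_inv_eq_iff_eq_mul, ← mul_assoc] using ha'.trans (mul_comm _ _)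
    · simp
    · simpa [mul_inv_eq_iff_eq_mul, ← mul_assoc] using (ha'.trans hx).trans (mul_comm _ _)

/-! ### A regular element and its centralizer -/

/-- A torus element with pairwise distinct eigenvalues. -/
noncomputable def regularElement : Fin 4 → ℂˣ :=
  fun b => Units.mk0 2 two_ne_zero ^ (![5, 3, 6, 2] b : ℕ)

theorem regularElement_zpow_injective {s t : ℤˣ} {b c : Fin 4}
    (h : regularElement b ^ (s : ℤ) = regularElement c ^ (t : ℤ)) : s = t ∧ b = c := by
  simp only [regularElement, ← zpow_natCast, ← zpow_mul] at h
  -- Passing to `ℝ` makes `n ↦ 2 ^ n` injective by monotonicity; what remains is that the signed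
  -- exponents `±5, ±3, ±6, ±2` are distinct.
  have h' : (2 : ℝ) ^ (((![5, 3, 6, 2] b : ℕ) : ℤ) * s) = 2 ^ (((![5, 3, 6, 2] c : ℕ) : ℤ) * t) := by
    have := congrArg (fun z : ℂˣ => (z : ℂ)) h
    simp only [Units.val_zpow_eq_zpow_val, Units.val_mk0] at this
    exact Complex.ofReal_injective (by push_cast; exact_mod_cast this)
  have key := zpow_right_injective₀ (by norm_num : (0 : ℝ) < 2) (by norm_num) h'
  clear h h'
  revert s t b c
  decide

theorem regularElement_mem_range :
    ∃ g ∈ torusHom.range, g.1 = torusMat regularElement := by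
  -- The exponents satisfy `5 + 3 = 6 + 2`.
  have h : regularElement 0 * regularElement 1 = regularElement 2 * regularElement 3 := by
    simp only [regularElement, ← pow_add]
    rfl
  refine ⟨⟨torusMat regularElement, ?_⟩, mem_range_torusHom_iff.2 ⟨_, h, rfl⟩, rfl⟩
  simp [torusMat, det_blockSum, det_Lmat]

/-- An orthogonal matrix commuting with a regular torus element is block diagonal with
blocks `L_x`. -/
theorem exists_eq_torusMat {g : Matrix (Fin 8) (Fin 8) ℂ} (horth : gᵀ * g = 1)
    (hcomm : g * torusMat regularElement = torusMat regularElement * g) :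
    ∃ x : Fin 4 → ℂˣ, g = torusMat x := by
  -- Commutation with simple spectrum: every off-line coordinate of the image is killed by a
  -- difference of distinct eigenvalues.
  have hg (s b) : g *ᵥ isoVec s b = (isoCoord s b (g *ᵥ isoVec s b) / 2) • isoVec s b := by
    refine ext_isoCoord fun t c => ?_
    rw [isoCoord_smul, isoCoord_isoVec]
    split_ifs with h
    · rw [h.1, h.2]; ring
    · have := congrArg (fun M => isoCoord t c (M *ᵥ isoVec s b)) hcomm
      simp only [← Matrix.mulVec_mulVec, isoCoord_torusMat, torusMat_mulVec_isoVec,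
        Matrix.mulVec_smul, isoCoord_smul] at this
      rw [mul_zero]
      by_contra h0
      have h1 := regularElement_zpow_injective (Units.ext (mul_right_cancel₀ h0 this))
      exact h ⟨h1.1.symm, h1.2.symm⟩
  -- `g` preserves the pairing of the two isotropic vectors of a block, which is nonzero, so their
  -- eigenvalues are inverse.
  have hmul (b) : (isoCoord 1 b (g *ᵥ isoVec 1 b) / 2) *
      (isoCoord (-1) b (g *ᵥ isoVec (-1) b) / 2) = 1 := by
    have h : (g *ᵥ isoVec 1 b) ⬝ᵥ (g *ᵥ isoVec (-1) b) = 2 := by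
      rw [Matrix.dotProduct_mulVec, ← Matrix.mulVec_transpose, Matrix.mulVec_mulVec, horth,
        Matrix.one_mulVec, isoVec_dotProduct_isoVec]
    rw [hg 1 b, hg (-1) b, smul_dotProduct, dotProduct_smul, isoVec_dotProduct_isoVec,
      smul_eq_mul, smul_eq_mul, ← mul_assoc] at h
    exact mul_right_cancel₀ two_ne_zero (h.trans (one_mul 2).symm)
  refine ⟨fun b => ⟨_, _, hmul b, (mul_comm _ _).trans (hmul b)⟩, ext_mulVec_isoVec fun s b => ?_⟩
  rw [torusMat_mulVec_isoVec, hg]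
  rcases Int.units_eq_one_or s with rfl | rfl <;> simp

theorem mul_eq_mul_of_cayleyPhi {x : Fin 4 → ℂˣ}
    (h : ∀ a b c d, cayleyPhi (torusMat x *ᵥ a) (torusMat x *ᵥ b) (torusMat x *ᵥ c)
      (torusMat x *ᵥ d) = cayleyPhi a b c d) : x 0 * x 1 = x 2 * x 3 := by
  -- These eigenvectors detect the mixed term of weight `x₀x₁/(x₂x₃)`, so invariance forces this
  -- weight to be `1`.
  have := h (isoVec 1 0) (isoVec 1 1) (isoVec (-1) 2) (isoVec (-1) 3)
  simp only [torusMat_mulVec_isoVec] at this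
  have e := cayleyPhi_smul ![(x 0 ^ ((1 : ℤˣ) : ℤ) : ℂˣ), (x 1 ^ ((1 : ℤˣ) : ℤ) : ℂˣ),
    (x 2 ^ ((-1 : ℤˣ) : ℤ) : ℂˣ), (x 3 ^ ((-1 : ℤˣ) : ℤ) : ℂˣ)]
    ![isoVec 1 0, isoVec 1 1, isoVec (-1) 2, isoVec (-1) 3]
  simp only [Matrix.cons_val] at e
  rw [e, cayleyPhi_isoVec, mul_eq_right₀ (by norm_num)] at this
  simp only [Fin.prod_univ_four, Matrix.cons_val, ← Units.val_mul, Units.val_eq_one] at this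
  simpa [mul_inv_eq_iff_eq_mul, mul_comm] using this

theorem mem_range_torusHom_of_comm {g k : Matrix.SpecialLinearGroup (Fin 8) ℂ}
    (hg : g ∈ cayleyStabilizer) (hk : k.1 = torusMat regularElement) (hcomm : g * k = k * g) :
    g ∈ torusHom.range := by
  have horth := hg.1
  rw [Matrix.mem_specialOrthogonalGroup_iff, Matrix.mem_orthogonalGroup_iff'] at horth
  obtain ⟨x, hx⟩ := exists_eq_torusMat horth.1 (by
    rw [← hk]; exact congrArg Subtype.val hcomm)
  exact mem_range_torusHom_iff.2 ⟨x, mul_eq_mul_of_cayleyPhi (hx ▸ hg.2), hx⟩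

/-! ### Containment in the identity component, and the kernel -/

theorem Spin7_le_cayleyStabilizer : Spin7 ≤ cayleyStabilizer := by
  rintro _ ⟨g, -, rfl⟩
  exact g.2

theorem torusHom_mem_cayleyStabilizer (t : ℂˣ × ℂˣ × ℂˣ) : torusHom t ∈ cayleyStabilizer := by
  obtain ⟨x, hx, h⟩ := mem_range_torusHom_iff.1 ⟨t, rfl⟩
  refine ⟨?_, ?_⟩
  · rw [Matrix.mem_specialOrthogonalGroup_iff, Matrix.mem_orthogonalGroup_iff']
    refine ⟨?_, (torusHom t).2⟩
    rw [h]
    exact torusMat_transpose_mul x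
  · rw [h]
    exact cayleyPhi_torusMat hx

theorem continuous_torusHom : Continuous torusHom := by
  refine Continuous.subtype_mk ?_ _
  have hL : Continuous Lmat := by
    refine continuous_matrix fun i j => ?_
    have h : Continuous fun a : ℂˣ => (a : ℂ)⁻¹ := by
      simpa [Function.comp_def] using Units.continuous_val.comp (continuous_inv (G := ℂˣ))
    have h' : Continuous fun a : ℂˣ => (a : ℂ) := Units.continuous_val
    fin_cases i <;> fin_cases j <;> simp [Lmat] <;> fun_prop
  simp only [ABC_eq]
  refine continuous_matrix fun i j => ?_
  obtain ⟨⟨p, b⟩, rfl⟩ := blockIndex.surjective i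
  obtain ⟨⟨q, c⟩, rfl⟩ := blockIndex.surjective j
  simp only [blockSum_apply]
  split_ifs
  · refine Continuous.matrix_elem ?_ p q
    fin_cases b <;> exact hL.comp (by fun_prop)
  · exact continuous_const

theorem range_torusHom_le_Spin7 : torusHom.range ≤ Spin7 := by
  rintro _ ⟨t, rfl⟩
  -- The identity component is taken inside the stabilizer, so the connected image must be viewed in
  -- that group.
  let F : ℂˣ × ℂˣ × ℂˣ → cayleyStabilizer := fun t =>
    ⟨torusHom t, torusHom_mem_cayleyStabilizer t⟩
  have hF : Continuous F := continuous_torusHom.subtype_mk _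
  have h1 : (1 : cayleyStabilizer) ∈ Set.range F := ⟨1, Subtype.ext (map_one torusHom)⟩
  exact ⟨F t, (isPreconnected_range hF).subset_connectedComponent h1 ⟨t, rfl⟩, rfl⟩

theorem ker_torusHom :
    (torusHom.ker : Set (ℂˣ × ℂˣ × ℂˣ)) = {(1, 1, 1), (-1, -1, -1)} := by
  ext ⟨a, b, c⟩
  have h : (a, b, c) ∈ torusHom.ker ↔ torusMat ![a * b, a * b⁻¹, a * c, a * c⁻¹] = torusMat 1 := by
    rw [MonoidHom.mem_ker, torusMat_one, ← Matrix.SpecialLinearGroup.coe_one, ← coe_torusHom (a, b, c)]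
    exact Subtype.ext_iff
  rw [SetLike.mem_coe, h, torusMat_injective.eq_iff]
  simp only [Set.mem_insert_iff, Set.mem_singleton_iff, Prod.mk.injEq]
  constructor
  · intro h
    have h0 : a * b = 1 := congrFun h 0
    have h1 : a * b⁻¹ = 1 := congrFun h 1
    have h3 : a * c⁻¹ = 1 := congrFun h 3
    obtain rfl : a = b := mul_inv_eq_one.1 h1
    obtain rfl : a = c := mul_inv_eq_one.1 h3
    have h2 : (a : ℂ) = 1 ∨ (a : ℂ) = -1 := by
      rw [← mul_self_eq_one_iff]; exact congrArg Units.val h0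
    rcases h2 with h2 | h2
    · exact Or.inl (by simpa using h2)
    · right
      have : a = -1 := Units.ext (by simpa using h2)
      simp [this]
  · rintro (⟨rfl, rfl, rfl⟩ | ⟨rfl, rfl, rfl⟩) <;> funext i <;> fin_cases i <;> simp

/-! ### The torus as an algebraic group -/

/-- Uses the full vanishing ideal of `S`, so that equations cutting out `S` can be supplied one at a
time. -/
theorem isZariskiClosed_of_forall {n : Type*} [Fintype n] [DecidableEq n]
    {S : Set (Matrix.SpecialLinearGroup n ℂ)}
    (h : ∀ g, (∀ p, (∀ k ∈ S, evalEntries p k = 0) → evalEntries p g = 0) → g ∈ S) :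
    IsZariskiClosed S :=
  ⟨{p | ∀ k ∈ S, evalEntries p k = 0}, Set.Subset.antisymm (fun _ hg _ hp => hp _ hg) h⟩

/-- The polynomial in the matrix entries whose value on `torusMat x` is `x b`. -/
noncomputable def coordPoly (b : Fin 4) : MvPolynomial (Fin 8 × Fin 8) ℂ :=
  MvPolynomial.X (blockIndex (0, b), blockIndex (0, b)) -
    MvPolynomial.C Complex.I * MvPolynomial.X (blockIndex (1, b), blockIndex (0, b))

theorem evalEntries_coordPoly {g : Matrix.SpecialLinearGroup (Fin 8) ℂ} {x : Fin 4 → ℂˣ}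
    (h : g.1 = torusMat x) (b : Fin 4) : evalEntries (coordPoly b) g = x b := by
  simp only [evalEntries, coordPoly, map_sub, map_mul, MvPolynomial.eval_X, MvPolynomial.eval_C, h,
    torusMat, blockSum_apply, if_true]
  simp only [Lmat, Matrix.of_apply, Matrix.cons_val]
  linear_combination -((x b : ℂ) - (x b : ℂ)⁻¹) / 2 * Complex.I_sq

theorem isZariskiClosed_range_torusHom :
    IsZariskiClosed (torusHom.range : Set (Matrix.SpecialLinearGroup (Fin 8) ℂ)) := by
  refine isZariskiClosed_of_forall fun g hg => ?_
  have mem {k} (hk : k ∈ (torusHom.range : Set (Matrix.SpecialLinearGroup (Fin 8) ℂ))) :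
      ∃ x : Fin 4 → ℂˣ, x 0 * x 1 = x 2 * x 3 ∧ k.1 = torusMat x := mem_range_torusHom_iff.1 hk
  have heval (P : Matrix (Fin 8) (Fin 8) (MvPolynomial (Fin 8 × Fin 8) ℂ)) (i j)
      (k : Matrix.SpecialLinearGroup (Fin 8) ℂ) : evalEntries (P i j) k =
        ((MvPolynomial.eval fun ij : Fin 8 × Fin 8 => k.1 ij.1 ij.2).mapMatrix P) i j := rfl
  have hX (k : Matrix.SpecialLinearGroup (Fin 8) ℂ) :
      (MvPolynomial.eval fun ij : Fin 8 × Fin 8 => k.1 ij.1 ij.2).mapMatrix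
        (Matrix.mvPolynomialX (Fin 8) (Fin 8) ℂ) = k.1 := by
    ext i j; simp
  have hC (k : Matrix.SpecialLinearGroup (Fin 8) ℂ) (M : Matrix (Fin 8) (Fin 8) ℂ) :
      (MvPolynomial.eval fun ij : Fin 8 × Fin 8 => k.1 ij.1 ij.2).mapMatrix
        (M.map (MvPolynomial.C (σ := Fin 8 × Fin 8))) = M := by
    ext i j; simp
  have hT (k : Matrix.SpecialLinearGroup (Fin 8) ℂ) :
      (MvPolynomial.eval fun ij : Fin 8 × Fin 8 => k.1 ij.1 ij.2).mapMatrix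
        (Matrix.mvPolynomialX (Fin 8) (Fin 8) ℂ)ᵀ = k.1ᵀ := by
    ext i j; simp
  have horth : g.1ᵀ * g.1 = 1 := by
    ext i j
    have := hg (((Matrix.mvPolynomialX (Fin 8) (Fin 8) ℂ)ᵀ *
      Matrix.mvPolynomialX (Fin 8) (Fin 8) ℂ - 1) i j) fun k hk => by
        obtain ⟨x, -, hx⟩ := mem hk
        rw [heval, map_sub, map_mul, map_one, hX, hT, hx, torusMat_transpose_mul, sub_self]
        rfl
    rw [heval, map_sub, map_mul, map_one, hX, hT] at this
    exact sub_eq_zero.1 this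
  -- For a constant matrix `R`, commutation is linear in the entries; it holds on the image because
  -- block sums of this type commute.
  have hcomm : g.1 * torusMat regularElement = torusMat regularElement * g.1 := by
    let R : Matrix (Fin 8) (Fin 8) (MvPolynomial (Fin 8 × Fin 8) ℂ) :=
      (torusMat regularElement).map MvPolynomial.C
    ext i j
    have := hg ((Matrix.mvPolynomialX (Fin 8) (Fin 8) ℂ * R - R * Matrix.mvPolynomialX (Fin 8) (Fin 8) ℂ) i j) fun k hk => by
        obtain ⟨x, -, hx⟩ := mem hk
        rw [heval, map_sub, map_mul, map_mul, hX, hC, hx, ← torusMat_mul, ← torusMat_mul,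
          mul_comm x, sub_self]
        rfl
    rw [heval, map_sub, map_mul, map_mul, hX, hC] at this
    exact sub_eq_zero.1 this
  obtain ⟨y, hy⟩ := exists_eq_torusMat horth hcomm
  refine mem_range_torusHom_iff.2 ⟨y, ?_, hy⟩
  have heq (k : Matrix.SpecialLinearGroup (Fin 8) ℂ) (x : Fin 4 → ℂˣ) (hx : k.1 = torusMat x) :
      evalEntries (coordPoly 0 * coordPoly 1 - coordPoly 2 * coordPoly 3) k =
        x 0 * x 1 - x 2 * x 3 := by
    simp only [← evalEntries_coordPoly hx, evalEntries, map_sub, map_mul]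
  have := hg (coordPoly 0 * coordPoly 1 - coordPoly 2 * coordPoly 3) fun k hk => by
    obtain ⟨x, hrel, hx⟩ := mem hk
    rw [heq k x hx, sub_eq_zero]
    exact_mod_cast congrArg Units.val hrel
  rw [heq g y hy, sub_eq_zero] at this
  exact Units.ext (by exact_mod_cast this)

/-- The parameters of the four blocks in terms of the first three. -/
def blockParams : (Fin 3 → ℂˣ) →* (Fin 4 → ℂˣ) where
  toFun t := ![t 0, t 1, t 2, t 0 * t 1 * (t 2)⁻¹]
  map_one' := by
    funext b
    fin_cases b <;> simp
  map_mul' s t := by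
    funext b
    fin_cases b
    · rfl
    · rfl
    · rfl
    · simp [mul_comm, mul_left_comm, mul_assoc]

theorem blockParams_castSucc (t : Fin 3 → ℂˣ) (k : Fin 3) : blockParams t k.castSucc = t k := by
  fin_cases k <;> rfl

/-- The parametrization of the torus by `(ℂ^×)³`. -/
noncomputable def torusParam : (Fin 3 → ℂˣ) →* Matrix.SpecialLinearGroup (Fin 8) ℂ where
  toFun t := ⟨torusMat (blockParams t), by simp [torusMat, det_blockSum, det_Lmat]⟩
  map_one' := Subtype.ext ((congrArg torusMat (map_one _)).trans torusMat_one)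
  map_mul' s t := Subtype.ext ((congrArg torusMat (map_mul _ s t)).trans (torusMat_mul _ _))

theorem torusParam_injective : Function.Injective torusParam := by
  intro s t h
  have := torusMat_injective (congrArg Subtype.val h)
  funext k
  rw [← blockParams_castSucc s, ← blockParams_castSucc t, this]

/-- Since `h` has kernel of order two, it is not itself an isomorphism onto its image. The first
three block parameters are free coordinates, and the relation determines the fourth. -/
theorem range_torusParam : torusParam.range = torusHom.range := by
  ext g
  rw [mem_range_torusHom_iff]
  constructor
  · rintro ⟨t, rfl⟩
    refine ⟨blockParams t, ?_, rfl⟩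
    change t 0 * t 1 = t 2 * (t 0 * t 1 * (t 2)⁻¹)
    simp [mul_left_comm]
  · rintro ⟨x, hx, hg⟩
    refine ⟨fun k => x k.castSucc, Subtype.ext ?_⟩
    rw [hg]
    change torusMat _ = _
    congr 1
    funext b
    fin_cases b
    · rfl
    · rfl
    · rfl
    · change x 0 * x 1 * (x 2)⁻¹ = x 3
      rw [hx]; simp [mul_comm]

theorem exists_laurent_blockParams (b : Fin 4) :
    ∃ p q : MvPolynomial (Fin 3 ⊕ Fin 3) ℂ, ∀ t : Fin 3 → ℂˣ,
      (blockParams t b : ℂ) =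
        MvPolynomial.eval (Sum.elim (fun k => (t k : ℂ)) (fun k => ((t k)⁻¹ : ℂ))) p ∧
      (blockParams t b : ℂ)⁻¹ =
        MvPolynomial.eval (Sum.elim (fun k => (t k : ℂ)) (fun k => ((t k)⁻¹ : ℂ))) q := by
  refine Fin.lastCases ?_ (fun k => ?_) b
  · refine ⟨.X (.inl 0) * .X (.inl 1) * .X (.inr 2), .X (.inr 0) * .X (.inr 1) * .X (.inl 2),
      fun t => ?_⟩
    have h : blockParams t (Fin.last 3) = t 0 * t 1 * (t 2)⁻¹ := rfl
    rw [h]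
    simp [mul_comm]
  · exact ⟨.X (.inl k), .X (.inr k), fun t => by simp [blockParams_castSucc]⟩

theorem isAlgebraicTorus_range_torusHom : IsAlgebraicTorus torusHom.range := by
  refine ⟨isZariskiClosed_range_torusHom, 3, (MonoidHom.ofInjective torusParam_injective).trans
    (MulEquiv.subgroupCongr range_torusParam), fun i j => ?_, fun k => ?_⟩
  · change ∃ p, ∀ t, torusMat (blockParams t) i j = _
    obtain ⟨⟨a, b⟩, rfl⟩ := blockIndex.surjective i
    obtain ⟨⟨a', c⟩, rfl⟩ := blockIndex.surjective j
    simp only [torusMat, blockSum_apply]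
    split_ifs
    · obtain ⟨p, q, h⟩ := exists_laurent_blockParams b
      have hP := fun t => (h t).1
      have hQ := fun t => (h t).2
      refine ⟨!![.C (1 / 2) * (p + q), .C (-Complex.I / 2) * (p - q);
        .C (Complex.I / 2) * (p - q), .C (1 / 2) * (p + q)] a a', fun t => ?_⟩
      fin_cases a <;> fin_cases a' <;> simp [Lmat, ← hP, ← hQ] <;> ring
    · exact ⟨0, fun t => by simp⟩
  · refine ⟨coordPoly k.castSucc, fun g => ?_⟩
    set f := (MonoidHom.ofInjective torusParam_injective).trans
      (MulEquiv.subgroupCongr range_torusParam)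
    obtain ⟨t, rfl⟩ := f.surjective g
    have h : (f t).1.1 = torusMat (blockParams t) := rfl
    rw [evalEntries_coordPoly h, blockParams_castSucc, f.symm_apply_apply]

/-! ### Maximality -/

theorem IsAlgebraicTorus.mul_comm {n : Type*} [Fintype n] [DecidableEq n]
    {T : Subgroup (Matrix.SpecialLinearGroup n ℂ)} (hT : IsAlgebraicTorus T)
    {g k : Matrix.SpecialLinearGroup n ℂ} (hg : g ∈ T) (hk : k ∈ T) : g * k = k * g := by
  obtain ⟨-, r, f, -⟩ := hT
  have : (⟨g, hg⟩ * ⟨k, hk⟩ : T) = ⟨k, hk⟩ * ⟨g, hg⟩ := f.symm.injective (by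
    rw [map_mul, map_mul, _root_.mul_comm])
  exact congrArg Subtype.val this

theorem mainTheorem7 :
    IsMaximalTorus torusHom.range Spin7 ∧
    (torusHom.ker : Set (ℂˣ × ℂˣ × ℂˣ)) = {(1, 1, 1), (-1, -1, -1)} := by
  refine ⟨⟨⟨isAlgebraicTorus_range_torusHom, range_torusHom_le_Spin7⟩, ?_⟩, ker_torusHom⟩
  rintro T ⟨hT, hTS⟩ hle g hg
  obtain ⟨k, hk, hk'⟩ := regularElement_mem_range
  -- Commutativity of the larger torus `T` suffices: each `g` in it commutes with the regular
  -- element `k`.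
  exact mem_range_torusHom_of_comm (Spin7_le_cayleyStabilizer (hTS hg)) hk'
    (hT.mul_comm hg (hle hk))
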